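/- For integers $n\ge 1$, $m\ge n$ and $d\ge 0$, write $m=n(1+\alpha)$ with $\alpha\ge 0$, and let $M^{\mathcal C}_{n,\alpha,d}$ be the following random stable matching instance with $m$ candidates and $n$ jobs. Each candidate chooses, uniformly at random and independently, an ordered preference list of $d$ distinct jobs, and each job, independently and uniformly at random, ranks the candidates that list it (equivalently, each job draws a uniformly random total order on all candidates and restricts it to the candidates that list it). A matching is a set of vertex-disjoint candidate–job pairs $(c,j)$ with $j$ on $c$'s list. It is stable if there is no pair $(c,j)$, with $j$ on $c$'s list, such that $c$ is unmatched or strictly prefers $j$ to its partner, and $j$ is unmatched or strictly prefers $c$ to its partner. It is perfect if every job is matched. **Theorem.** There is an absolute constant $c>0$ such that for every $\gamma>0$ there is $N=N(\gamma)$ with the following property. For all $n\ge N$, all $\alpha\ge 0$ for which $n(1+\alpha)$ is an integer, and all integers $d\ge 0$ with $$d<(1-\gamma)\,\ln n\cdot\ln\!\left(\frac{1+\alpha}{\alpha+\frac{1}{n(1+\alpha)}}\right),$$ we have $$\mathbb P\bigl(M^{\mathcal C}_{n,\alpha,d}\text{ has no perfect stable matching}\bigr)\ \ge\ 1-\left(\alpha+\frac1n\right)^{c\gamma}.$$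 -/

import Mathlib

/-- A two-sided matching instance: every candidate has a strict, possibly partial, preference list
of jobs and every job one of candidates, from most to least preferred. -/
structure MatchingInstance (C J : Type*) where
  candList : C → List J
  candList_nodup : ∀ c, (candList c).Nodup
  jobList : J → List C
  jobList_nodup : ∀ j, (jobList j).Nodup

namespace MatchingInstance

variable {C J : Type*}

/-- The edges of the bipartite graph of the instance: mutually listed pairs. -/
def Edge (I : MatchingInstance C J) (c : C) (j : J) : Prop :=
  j ∈ I.candList c ∧ c ∈ I.jobList j

/-- A matching is a set of vertex-disjoint edges. -/
structure IsMatching (I : MatchingInstance C J) (μ : Set (C × J)) : Prop where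
  edge : ∀ c j, (c, j) ∈ μ → I.Edge c j
  job_unique : ∀ c j j', (c, j) ∈ μ → (c, j') ∈ μ → j = j'
  cand_unique : ∀ c c' j, (c, j) ∈ μ → (c', j) ∈ μ → c = c'

/-- Candidate `c` strictly prefers the listed job `j` to `j'`. -/
def CandPrefers [DecidableEq J] (I : MatchingInstance C J) (c : C) (j j' : J) : Prop :=
  j ∈ I.candList c ∧ (I.candList c).idxOf j < (I.candList c).idxOf j'

/-- Job `j` strictly prefers the listed candidate `c` to `c'`. -/
def JobPrefers [DecidableEq C] (I : MatchingInstance C J) (j : J) (c c' : C) : Prop :=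
  c ∈ I.jobList j ∧ (I.jobList j).idxOf c < (I.jobList j).idxOf c'

/-- `(c, j)` blocks `μ`: `c` and `j` list each other, and each of them is unmatched in `μ` or
strictly prefers the other to its partner in `μ`. (Partners in a matching are always listed, so
no agent ever prefers being unmatched to its partner.) -/
def Blocks [DecidableEq C] [DecidableEq J] (I : MatchingInstance C J) (μ : Set (C × J))
    (c : C) (j : J) : Prop :=
  I.Edge c j ∧ (∀ j', (c, j') ∈ μ → I.CandPrefers c j j') ∧
    (∀ c', (c', j) ∈ μ → I.JobPrefers j c c')

/-- A stable matching is a matching without a blocking pair. -/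
def IsStable [DecidableEq C] [DecidableEq J] (I : MatchingInstance C J)
    (μ : Set (C × J)) : Prop :=
  I.IsMatching μ ∧ ∀ c j, ¬ I.Blocks μ c j

/-- Some stable matching is perfect, that is, matches every job. -/
def HasPerfectStableMatching [DecidableEq C] [DecidableEq J] (I : MatchingInstance C J) : Prop :=
  ∃ μ : Set (C × J), I.IsStable μ ∧ ∀ j, ∃ c, (c, j) ∈ μ

end MatchingInstance

/-- An outcome of the candidate-list model with `m` candidates, `n` jobs and list length `d`: every
candidate draws an ordered list of `d` distinct jobs and every job draws a total order on the
candidates (`jobOrder j i` is the candidate in position `i`). -/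
abbrev CandidateListSample (m n d : ℕ) : Type :=
  (Fin m → (Fin d ↪ Fin n)) × (Fin n → Equiv.Perm (Fin m))

instance (m n d : ℕ) : MeasurableSpace (CandidateListSample m n d) := ⊤

/-- The instance determined by an outcome. The list of job `j` consists of the candidates that
list `j`, in the order induced by the total order drawn by `j`; under the uniform law these are
independent uniform rankings of the neighbours. -/
def CandidateListSample.toInstance {m n d : ℕ} (ω : CandidateListSample m n d) :
    MatchingInstance (Fin m) (Fin n) where
  candList c := List.ofFn (ω.1 c)
  candList_nodup c := List.nodup_ofFn.2 (ω.1 c).injective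
  jobList j := ((List.finRange m).map (ω.2 j)).filter fun c => decide (∃ i, ω.1 c i = j)
  jobList_nodup j := ((List.nodup_finRange m).map (ω.2 j).injective).filter _

/-- The law of the candidate-list model: all lists and all orders are drawn independently and
uniformly, i.e. the outcome is uniform on the (finite) product space. -/
noncomputable def candidateListLaw (m n d : ℕ) :
    MeasureTheory.Measure (CandidateListSample m n d) :=
  ProbabilityTheory.uniformOn Set.univ

/-!
The proof is a first-moment computation: below the threshold, the expected number of perfect stable
matchings is at most `1 / n`, and indeed smaller than any power of `1 / n`.

Fix a matching `μ` of all jobs and the positions `k j` of the jobs on their partners' lists. It is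
stable only if every job listed by a candidate ahead of its partner prefers its own partner
(`exists_isStableWitness`). Given the lists, a job with `t` such candidates complies with
probability `1 / (t + 1) = ∫ x in [0, 1], x ^ t`, so that the probability becomes an integral over
the cube `[0, 1] ^ n` whose integrand is a product over the candidates (`card_jobOrders_le`).
Replacing lists of distinct jobs by arbitrary ones costs a factor `exp (O((log n) ^ 4))` and turns
the sum over all lists into a function of the mean `q` of the coordinates alone. Summing over `k`
and `μ` gives `measure_hasPerfectStableMatching_le`: the first moment is at most this factor times
`n! ∫ s⁻ⁿ P(Bin(m, 1 - Q) = n)`, where `s = n (1 - q)` and `Q = q ^ d` is the probability that a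
candidate is rejected by its whole list.

Two effects make this small. If `s ≤ n / ((1 - γ / 2) log n)`, then `m Q` exceeds the number
`m - n` of unmatched candidates by a constant factor, and Chernoff's bound makes the binomial
probability at most `exp (-κ n ^ (γ / 4))` (`choose_mul_rejection_le`). For larger `s`, the bound
`s⁻ⁿ ≤ (u / n) ^ n exp (n + 1 - u s)` for `u` just above `n / s`, together with
`∫ exp (-u s) = ((1 - exp (-u)) / u) ^ n`, leaves `(1 - exp (-u)) ^ n ≤ exp (-n exp (-u))`: with
only `u ≤ (1 - γ / 2) log n + 1 / n` proposals per job, as in the coupon collector's problem, some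
job receives none. Letting `u` run over a grid covers all `s` by polynomially many such bounds
(`momentIntegrand_le`, `integral_momentIntegrand_le`).
-/

open MeasureTheory Finset
open scoped Nat

/-! ### Uniform orders -/

/-- By symmetry, each element of `insert a T` is first among them in equally many orders. -/
theorem card_perm_first_mul_le {m : ℕ} (a : Fin m) (T : Finset (Fin m)) (ha : a ∉ T) :
    #{σ : Equiv.Perm (Fin m) | ∀ c ∈ T, σ.symm a ≤ σ.symm c} * (#T + 1) ≤ m ! := by
  classical
  set A : Fin m → Finset (Equiv.Perm (Fin m)) :=
    fun t => {σ | ∀ c ∈ insert a T, σ.symm t ≤ σ.symm c} with hA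
  have hcard : ∀ t ∈ insert a T, #(A a) ≤ #(A t) := by
    intro t ht
    refine Finset.card_le_card_of_injOn (fun σ => σ.trans (Equiv.swap a t)) ?_ ?_
    · intro σ hσ
      simp only [hA, coe_filter, mem_univ, true_and, Set.mem_ofPred_eq] at hσ ⊢
      intro c hc
      simp only [Equiv.symm_trans_apply, Equiv.symm_swap, Equiv.swap_apply_right]
      apply hσ
      rcases eq_or_ne c a with rfl | h1
      · simpa using ht
      rcases eq_or_ne c t with rfl | h2
      · simp
      · rwa [Equiv.swap_apply_of_ne_of_ne h1 h2]
    · intro σ _ τ _ h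
      ext x
      have := congrArg (fun e : Equiv.Perm (Fin m) => Equiv.swap a t (e x)) h
      simpa using congrArg Fin.val this
  have hdisj : ((insert a T : Finset (Fin m)) : Set (Fin m)).PairwiseDisjoint A := by
    intro s hs t ht hst
    refine Finset.disjoint_left.2 fun σ h1 h2 => hst ?_
    simp only [hA, mem_filter, mem_univ, true_and] at h1 h2
    exact σ.symm.injective (le_antisymm (h1 t ht) (h2 s hs))
  have heq : ({σ : Equiv.Perm (Fin m) | ∀ c ∈ T, σ.symm a ≤ σ.symm c} : Finset _) = A a := by
    ext σ
    simp [hA]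
  rw [heq]
  calc #(A a) * (#T + 1) = ∑ _t ∈ insert a T, #(A a) := by
        rw [sum_const, card_insert_of_notMem ha, smul_eq_mul, mul_comm]
    _ ≤ ∑ t ∈ insert a T, #(A t) := sum_le_sum hcard
    _ = #((insert a T).biUnion A) := (card_biUnion hdisj).symm
    _ ≤ #(univ : Finset (Equiv.Perm (Fin m))) := card_le_card (subset_univ _)
    _ = m ! := by rw [card_univ, Fintype.card_perm, Fintype.card_fin]

theorem symm_le_symm_of_idxOf_le {m : ℕ} (σ : Equiv.Perm (Fin m)) (p : Fin m → Bool) {a b : Fin m}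
    (ha : a ∈ ((List.finRange m).map σ).filter p)
    (hb : b ∈ ((List.finRange m).map σ).filter p)
    (h : (((List.finRange m).map σ).filter p).idxOf a ≤
      (((List.finRange m).map σ).filter p).idxOf b) : σ.symm a ≤ σ.symm b := by
  have hp : (((List.finRange m).map σ).filter p).Pairwise fun x y => σ.symm x < σ.symm y := by
    apply List.Pairwise.filter
    rw [List.pairwise_map]
    simpa using List.pairwise_lt_finRange m
  set L := ((List.finRange m).map σ).filter p
  have ha' := List.idxOf_lt_length_of_mem ha
  have hb' := List.idxOf_lt_length_of_mem hb
  rcases h.lt_or_eq with h | h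
  · have := List.pairwise_iff_getElem.1 hp _ _ ha' hb' h
    simpa using this.le
  · have : a = b := (List.idxOf_inj ha).1 h
    rw [this]

/-! ### Stability in terms of lists and orders -/

/-- The number of entries that candidate `c` lists ahead of its partner, when job `j` is matched
to the candidate `μ j`, who has it in position `k j`; the whole list if `c` is unmatched. -/
noncomputable def prefixLength {m n d : ℕ} (μ : Fin n ↪ Fin m) (k : Fin n → Fin d) (c : Fin m) :
    ℕ :=
  open Classical in if h : ∃ j, μ j = c then k h.choose else d

theorem prefixLength_apply {m n d : ℕ} (μ : Fin n ↪ Fin m) (k : Fin n → Fin d) (j : Fin n) :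
    prefixLength μ k (μ j) = k j := by
  have h : ∃ j', μ j' = μ j := ⟨j, rfl⟩
  rw [prefixLength, dif_pos h, μ.injective h.choose_spec]

theorem prefixLength_of_notMem {m n d : ℕ} (μ : Fin n ↪ Fin m) (k : Fin n → Fin d) {c : Fin m}
    (h : ¬ ∃ j, μ j = c) : prefixLength μ k c = d :=
  dif_neg h

/-- In the outcome `ω`, job `j` is in position `k j` on the list of `μ j`, and every job that some
candidate lists ahead of its partner prefers its own partner to that candidate. Every stable
matching that matches job `j` to `μ j` for all `j` has this property. -/
def IsStableWitness {m n d : ℕ} (ω : CandidateListSample m n d) (μ : Fin n ↪ Fin m)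
    (k : Fin n → Fin d) : Prop :=
  (∀ j, ω.1 (μ j) (k j) = j) ∧ ∀ (c : Fin m) (i : Fin d), (i : ℕ) < prefixLength μ k c →
    (ω.2 (ω.1 c i)).symm (μ (ω.1 c i)) ≤ (ω.2 (ω.1 c i)).symm c

theorem exists_isStableWitness {m n d : ℕ} (ω : CandidateListSample m n d)
    (h : ω.toInstance.HasPerfectStableMatching) : ∃ μ k, IsStableWitness ω μ k := by
  obtain ⟨M, ⟨hM, hst⟩, hperf⟩ := h
  choose μ hμ using hperf
  have hinj : Function.Injective μ := fun j j' h =>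
    hM.job_unique (μ j) j j' (hμ j) (by rw [h]; exact hμ j')
  have hk : ∀ j, ∃ k, ω.1 (μ j) k = j := by
    intro j
    have := (hM.edge _ _ (hμ j)).1
    simpa [CandidateListSample.toInstance, List.mem_ofFn] using this
  choose k hk using hk
  have hidx : ∀ c (i : Fin d), (ω.toInstance.candList c).idxOf (ω.1 c i) = i := by
    intro c i
    have hn := ω.toInstance.candList_nodup c
    have hlen : (ω.toInstance.candList c).length = d := by simp [CandidateListSample.toInstance]
    have := hn.idxOf_getElem i (by rw [hlen]; exact i.2)
    simpa [CandidateListSample.toInstance] using this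
  refine ⟨⟨μ, hinj⟩, k, hk, ?_⟩
  intro c i hi
  simp only [Function.Embedding.coeFn_mk]
  set j := ω.1 c i with hj
  have hcmem : j ∈ ω.toInstance.candList c := by
    simp [CandidateListSample.toInstance, List.mem_ofFn, hj]
  have hjmem : c ∈ ω.toInstance.jobList j := by
    simp only [CandidateListSample.toInstance, List.mem_filter, List.mem_map, List.mem_finRange,
      true_and, decide_eq_true_eq]
    exact ⟨⟨(ω.2 j).symm c, by simp⟩, i, hj.symm⟩
  have hnb := hst c j
  rw [MatchingInstance.Blocks] at hnb
  push Not at hnb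
  obtain ⟨c', hc', hpref⟩ := hnb ⟨hcmem, hjmem⟩ (by
    intro j' hj'
    have hc : c = μ j' := hM.cand_unique _ _ _ hj' (hμ j')
    refine ⟨hcmem, ?_⟩
    have h1 := prefixLength_apply ⟨μ, hinj⟩ k j'
    have h2 : (ω.toInstance.candList c).idxOf j' = k j' := by
      rw [hc]
      conv_lhs => rw [← hk j']
      simpa [hk j'] using hidx (μ j') (k j')
    rw [h2, hj, hidx]
    rw [hc] at hi
    exact hi.trans_eq h1)
  obtain rfl : c' = μ j := hM.cand_unique _ _ _ hc' (hμ j)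
  have hjmem' : μ j ∈ ω.toInstance.jobList j := (hM.edge _ _ (hμ j)).2
  have hle : ¬ (ω.toInstance.jobList j).idxOf c < (ω.toInstance.jobList j).idxOf (μ j) :=
    fun hlt => hpref ⟨hjmem, hlt⟩
  exact symm_le_symm_of_idxOf_le (ω.2 j) _ hjmem' hjmem (not_lt.1 hle)

/-! ### The first moment as an integral over the cube -/

theorem integral_unitInterval_pow (t : ℕ) :
    ∫ x : unitInterval, (x : ℝ) ^ t = 1 / ((t : ℝ) + 1) := by
  have h := integral_subtype (G := ℝ) (s := unitInterval) measurableSet_Icc (fun x : ℝ => x ^ t)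
  refine h.trans ?_
  rw [unitInterval, integral_Icc_eq_integral_Ioc, ← intervalIntegral.integral_of_le zero_le_one,
    integral_pow]
  simp

theorem integrable_cube {n : ℕ} {f : (Fin n → unitInterval) → ℝ} (hf : Continuous f) :
    Integrable f :=
  hf.integrable_of_hasCompactSupport (HasCompactSupport.of_compactSpace f)

open Classical in
/-- Given the candidates' lists, the orders of the jobs are compatible with a stable matching with
probability `∏ j, 1 / (T j + 1)`, where `T j` candidates prefer `j` to their partner. As
`1 / (t + 1) = ∫ x in [0, 1], x ^ t`, this is an integral over the cube whose integrand is a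
product over the candidates. -/
theorem card_jobOrders_le {m n d : ℕ} (μ : Fin n ↪ Fin m) (k : Fin n → Fin d)
    (l : Fin m → (Fin d ↪ Fin n)) (hl : ∀ j, l (μ j) (k j) = j) :
    (#{τ : Fin n → Equiv.Perm (Fin m) | IsStableWitness (l, τ) μ k} : ℝ) ≤
      (m ! : ℝ) ^ n * ∫ z : Fin n → unitInterval,
        ∏ c, ∏ i : Fin d with i.val < prefixLength μ k c, (z (l c i) : ℝ) := by
  classical
  set T : Fin n → Finset (Fin m) :=
    fun j => {c | ∃ i : Fin d, (i : ℕ) < prefixLength μ k c ∧ l c i = j} with hT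
  have hnot : ∀ j, μ j ∉ T j := by
    intro j hj
    simp only [hT, mem_filter, mem_univ, true_and, prefixLength_apply] at hj
    obtain ⟨i, hi, hij⟩ := hj
    have : i = k j := (l (μ j)).injective (hij.trans (hl j).symm)
    simp [this] at hi
  have hset : ({τ : Fin n → Equiv.Perm (Fin m) | IsStableWitness (l, τ) μ k} : Finset _) =
      Fintype.piFinset fun j => {σ | ∀ c ∈ T j, σ.symm (μ j) ≤ σ.symm c} := by
    ext τ
    rw [mem_filter, Fintype.mem_piFinset]
    simp only [mem_filter, mem_univ, true_and, hT]
    constructor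
    · rintro ⟨-, h⟩ j c ⟨i, hi, rfl⟩
      exact h c i hi
    · intro h
      exact ⟨hl, fun c i hi => h _ c ⟨i, hi, rfl⟩⟩
  have hprod : ∀ z : Fin n → unitInterval,
      ∏ c, ∏ i : Fin d with i.val < prefixLength μ k c, (z (l c i) : ℝ) =
        ∏ j, (z j : ℝ) ^ #(T j) := by
    intro z
    have h1 : ∀ c, ∏ i : Fin d with i.val < prefixLength μ k c, (z (l c i) : ℝ) =
        ∏ j, if c ∈ T j then (z j : ℝ) else 1 := by
      intro c
      rw [← prod_filter]
      refine (prod_map _ (l c) fun j => (z j : ℝ)).symm.trans (prod_congr ?_ fun _ _ => rfl)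
      ext j
      simp [hT]
    rw [prod_congr rfl fun c _ => h1 c, prod_comm]
    refine prod_congr rfl fun j _ => ?_
    rw [← prod_filter, prod_const]
    congr 2
    ext c
    simp
  simp_rw [hprod]
  rw [integral_fintype_prod_volume_eq_prod (fun j (x : unitInterval) => (x : ℝ) ^ #(T j)), hset,
    Fintype.card_piFinset, Nat.cast_prod]
  calc ∏ j, (#{σ : Equiv.Perm (Fin m) | ∀ c ∈ T j, σ.symm (μ j) ≤ σ.symm c} : ℝ)
      ≤ ∏ j, (m ! : ℝ) * ∫ x : unitInterval, (x : ℝ) ^ #(T j) := by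
        refine prod_le_prod (fun _ _ => by positivity) fun j _ => ?_
        rw [integral_unitInterval_pow, mul_one_div, le_div_iff₀ (by positivity)]
        exact_mod_cast card_perm_first_mul_le (μ j) (T j) (hnot j)
    _ = _ := by rw [prod_mul_distrib, prod_const, card_univ, Fintype.card_fin]

/-- Replacing lists of distinct jobs by arbitrary lists makes the sum over all lists a product. -/
theorem sum_embedding_le_prod {m n d : ℕ} (C : Fin m → (Fin d → Fin n) → Prop)
    [∀ c, DecidablePred (C c)] (g : Fin m → (Fin d → Fin n) → ℝ) (hg : ∀ c f, 0 ≤ g c f) :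
    ∑ l : Fin m → (Fin d ↪ Fin n) with ∀ c, C c (l c), ∏ c, g c (l c) ≤
      ∏ c, ∑ f : Fin d → Fin n with C c f, g c f := by
  classical
  rw [prod_univ_sum]
  have hinj : Function.Injective
      fun (l : Fin m → (Fin d ↪ Fin n)) (c : Fin m) => (l c : Fin d → Fin n) := by
    intro l l' h
    funext c
    exact DFunLike.coe_injective (congrFun h c)
  refine (sum_map _ ⟨_, hinj⟩ fun F : Fin m → Fin d → Fin n => ∏ c, g c (F c)).symm.trans_le ?_
  refine sum_le_sum_of_subset_of_nonneg ?_ fun F _ _ => prod_nonneg fun c _ => hg _ _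
  intro F hF
  simp only [mem_map, mem_filter, mem_univ, true_and] at hF
  obtain ⟨l, hl, rfl⟩ := hF
  simpa [Fintype.mem_piFinset] using hl

/-- The mean of the coordinates of a point of the cube. -/
noncomputable def cubeMean {n : ℕ} (z : Fin n → unitInterval) : ℝ := (∑ j, (z j : ℝ)) / n

theorem cubeMean_nonneg {n : ℕ} (z : Fin n → unitInterval) : 0 ≤ cubeMean z :=
  div_nonneg (sum_nonneg fun j _ => (z j).2.1) (Nat.cast_nonneg n)

theorem continuous_cubeMean {n : ℕ} : Continuous (cubeMean (n := n)) := by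
  unfold cubeMean
  fun_prop

theorem sum_matched_lists {n d : ℕ} (hn : 0 < n) (z : Fin n → unitInterval) (k : Fin d)
    (j : Fin n) :
    ∑ f : Fin d → Fin n with f k = j, ∏ i : Fin d with i.val < k.val, (z (f i) : ℝ) =
      (n : ℝ) ^ d * (cubeMean z ^ (k : ℕ) / n) := by
  classical
  have hn' : (n : ℝ) ≠ 0 := by positivity
  have hset : ({f : Fin d → Fin n | f k = j} : Finset _) =
      Fintype.piFinset fun i => if i = k then {j} else univ := by
    ext f
    simp only [mem_filter, mem_univ, true_and, Fintype.mem_piFinset]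
    constructor
    · rintro rfl i
      split_ifs with h <;> simp [h]
    · intro h
      simpa using h k
  simp_rw [hset, prod_filter]
  rw [← prod_univ_sum (fun i => if i = k then {j} else univ)
    (fun (i : Fin d) (x : Fin n) => if (i : ℕ) < k then (z x : ℝ) else 1)]
  have hterm : ∀ i : Fin d, (∑ x ∈ (if i = k then ({j} : Finset (Fin n)) else univ),
      if (i : ℕ) < k then (z x : ℝ) else 1) =
        n * ((if i ∈ Iio k then cubeMean z else 1) * (if i = k then (1 / n : ℝ) else 1)) := by
    intro i
    rcases eq_or_ne i k with rfl | h
    · simp [hn']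
    · by_cases hlt : (i : ℕ) < k
      · have : i < k := hlt
        simp only [h, if_false, hlt, if_true, mem_Iio, this, mul_one, cubeMean]
        field_simp
      · have : ¬ i < k := hlt
        simp [h, hlt, this]
  simp_rw [hterm]
  rw [prod_mul_distrib, prod_mul_distrib, prod_const, card_univ, Fintype.card_fin]
  simp only [prod_ite_mem, univ_inter, prod_const, Fin.card_Iio, prod_ite_eq', mem_univ, if_true]
  ring

theorem sum_unmatched_lists {n d : ℕ} (hn : 0 < n) (z : Fin n → unitInterval) :
    ∑ f : Fin d → Fin n, ∏ i : Fin d, (z (f i) : ℝ) = (n : ℝ) ^ d * cubeMean z ^ d := by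
  have hn' : (n : ℝ) ≠ 0 := by positivity
  rw [← Fintype.piFinset_univ, sum_prod_piFinset univ fun (_ : Fin d) (x : Fin n) => (z x : ℝ),
    prod_const, card_univ, Fintype.card_fin, ← mul_pow, cubeMean, mul_div_cancel₀ _ hn']

open Classical in
theorem card_isStableWitness_le {m n d : ℕ} (hn : 0 < n) (μ : Fin n ↪ Fin m)
    (k : Fin n → Fin d) :
    (#{ω : CandidateListSample m n d | IsStableWitness ω μ k} : ℝ) ≤
      (m ! : ℝ) ^ n * ((n : ℝ) ^ d) ^ m * ∫ z : Fin n → unitInterval,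
        (∏ j, cubeMean z ^ (k j : ℕ) / n) * (cubeMean z ^ d) ^ (m - n) := by
  classical
  have hsplit : (#{ω : CandidateListSample m n d | IsStableWitness ω μ k} : ℝ) =
      ∑ l : Fin m → (Fin d ↪ Fin n) with ∀ c, ∀ j, μ j = c → l c (k j) = j,
        (#{τ : Fin n → Equiv.Perm (Fin m) | IsStableWitness (l, τ) μ k} : ℝ) := by
    rw [sum_filter, card_filter, Fintype.sum_prod_type, Nat.cast_sum]
    refine sum_congr rfl fun l _ => ?_
    split_ifs with h
    · rw [card_filter]
    · rw [Nat.cast_eq_zero]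
      refine sum_eq_zero fun τ _ => if_neg fun hw => h ?_
      rintro c j rfl
      exact hw.1 j
  have hprod : ∀ z : Fin n → unitInterval,
      ∏ c, ∑ f : Fin d → Fin n with ∀ j, μ j = c → f (k j) = j,
        ∏ i : Fin d with i.val < prefixLength μ k c, (z (f i) : ℝ) =
      ((n : ℝ) ^ d) ^ m * ((∏ j, cubeMean z ^ (k j : ℕ) / n) * (cubeMean z ^ d) ^ (m - n)) := by
    intro z
    have hle : n ≤ m := by simpa using Fintype.card_le_of_embedding μ
    rw [← prod_mul_prod_compl (univ.map μ), prod_map]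
    have h1 : ∀ j, (∑ f : Fin d → Fin n with ∀ j', μ j' = μ j → f (k j') = j',
        ∏ i : Fin d with i.val < prefixLength μ k (μ j), (z (f i) : ℝ)) =
          (n : ℝ) ^ d * (cubeMean z ^ (k j : ℕ) / n) := by
      intro j
      rw [← sum_matched_lists hn z (k j) j, prefixLength_apply]
      refine sum_congr ?_ fun _ _ => rfl
      ext f
      simp
    have h2 : ∀ c ∈ (univ.map μ)ᶜ, (∑ f : Fin d → Fin n with ∀ j', μ j' = c → f (k j') = j',
        ∏ i : Fin d with i.val < prefixLength μ k c, (z (f i) : ℝ)) =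
          (n : ℝ) ^ d * cubeMean z ^ d := by
      intro c hc
      simp only [mem_compl, mem_map, mem_univ, true_and] at hc
      rw [← sum_unmatched_lists hn z, prefixLength_of_notMem μ k hc]
      rw [filter_true_of_mem fun f _ j' h => absurd ⟨j', h⟩ hc]
      simp
    rw [prod_congr rfl fun j _ => h1 j, prod_congr rfl h2, prod_mul_distrib, prod_const,
      prod_const, card_compl, card_map, card_univ, Fintype.card_fin, Fintype.card_fin, mul_pow]
    calc _ = (((n : ℝ) ^ d) ^ n * ((n : ℝ) ^ d) ^ (m - n)) *
          ((∏ j, cubeMean z ^ (k j : ℕ) / n) * (cubeMean z ^ d) ^ (m - n)) := by ring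
      _ = _ := by rw [← pow_add, Nat.add_sub_cancel' hle]
  rw [hsplit]
  calc _ ≤ ∑ l : Fin m → (Fin d ↪ Fin n) with ∀ c, ∀ j, μ j = c → l c (k j) = j,
        (m ! : ℝ) ^ n * ∫ z : Fin n → unitInterval,
          ∏ c, ∏ i : Fin d with i.val < prefixLength μ k c, (z (l c i) : ℝ) := by
        refine sum_le_sum fun l hl => card_jobOrders_le μ k l fun j => ?_
        exact (mem_filter.1 hl).2 _ j rfl
    _ = (m ! : ℝ) ^ n * ∫ z : Fin n → unitInterval,
          ∑ l : Fin m → (Fin d ↪ Fin n) with ∀ c, ∀ j, μ j = c → l c (k j) = j,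
          ∏ c, ∏ i : Fin d with i.val < prefixLength μ k c, (z (l c i) : ℝ) := by
        rw [← mul_sum, integral_finsetSum]
        intro l _
        exact integrable_cube (by fun_prop)
    _ ≤ (m ! : ℝ) ^ n * ∫ z : Fin n → unitInterval,
          ((n : ℝ) ^ d) ^ m *
            ((∏ j, cubeMean z ^ (k j : ℕ) / n) * (cubeMean z ^ d) ^ (m - n)) := by
        refine mul_le_mul_of_nonneg_left (integral_mono ?_ ?_ ?_) (by positivity)
        · exact integrable_cube (by fun_prop)
        · have := continuous_cubeMean (n := n)
          exact integrable_cube (by fun_prop)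
        · intro z
          dsimp only
          rw [← hprod z]
          convert sum_embedding_le_prod (fun c f => ∀ j, μ j = c → f (k j) = j)
            (fun c f => ∏ i : Fin d with i.val < prefixLength μ k c, (z (f i) : ℝ))
            fun c f => prod_nonneg fun i _ => (z (f i)).2.1
    _ = _ := by rw [integral_const_mul, mul_assoc]

/-- The integrand of the first-moment bound, as a function of the mean `q` of the coordinates: a
job's partner is in a uniformly chosen position and rejected nowhere before, and the `m - n`
unmatched candidates are rejected throughout their lists. -/
noncomputable def momentIntegrand (n m d : ℕ) (q : ℝ) : ℝ :=
  ((∑ k ∈ range d, q ^ k) / n) ^ n * (q ^ d) ^ (m - n)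

/-- The first-moment bound: the union bound over all matchings `μ` of the jobs and all positions
`k` of the partners. -/
theorem measure_hasPerfectStableMatching_le {m n d : ℕ} (hn : 0 < n) (hd : d ≤ n) :
    (candidateListLaw m n d).real {ω | ω.toInstance.HasPerfectStableMatching} ≤
      ((n : ℝ) ^ d / n.descFactorial d) ^ m * (m.descFactorial n *
        ∫ z : Fin n → unitInterval, momentIntegrand n m d (cubeMean z)) := by
  classical
  unfold momentIntegrand
  have hcard : Fintype.card (CandidateListSample m n d) =
      n.descFactorial d ^ m * m ! ^ n := by
    simp [CandidateListSample, Fintype.card_prod, Fintype.card_embedding_eq, Fintype.card_perm]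
  have hdesc : 0 < n.descFactorial d := Nat.descFactorial_pos.2 hd
  have hmeas : (candidateListLaw m n d).real {ω | ω.toInstance.HasPerfectStableMatching} =
      (#{ω : CandidateListSample m n d | ω.toInstance.HasPerfectStableMatching} : ℝ) /
        ((n.descFactorial d : ℝ) ^ m * (m ! : ℝ) ^ n) := by
    rw [candidateListLaw, measureReal_def, ProbabilityTheory.uniformOn_univ, ENNReal.toReal_div,
      hcard, Measure.count_apply (MeasurableSet.of_discrete), Set.encard_eq_coe_toFinset_card]
    simp
  have hsum : ∑ μ : Fin n ↪ Fin m, ∑ k : Fin n → Fin d,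
      (#{ω : CandidateListSample m n d | IsStableWitness ω μ k} : ℝ) ≤
        m.descFactorial n * ((m ! : ℝ) ^ n * ((n : ℝ) ^ d) ^ m * ∫ z : Fin n → unitInterval,
          ((∑ k ∈ range d, cubeMean z ^ k) / n) ^ n * (cubeMean z ^ d) ^ (m - n)) := by
    calc _ ≤ ∑ _μ : Fin n ↪ Fin m, ∑ k : Fin n → Fin d,
        (m ! : ℝ) ^ n * ((n : ℝ) ^ d) ^ m * ∫ z : Fin n → unitInterval,
          (∏ j, cubeMean z ^ (k j : ℕ) / n) * (cubeMean z ^ d) ^ (m - n) :=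
          sum_le_sum fun μ _ => sum_le_sum fun k _ => card_isStableWitness_le hn μ k
      _ = _ := by
        have := continuous_cubeMean (n := n)
        rw [sum_const, card_univ, Fintype.card_embedding_eq, Fintype.card_fin, Fintype.card_fin,
          nsmul_eq_mul, ← mul_sum, ← integral_finsetSum]
        · congr 2
          refine integral_congr_ae (Filter.Eventually.of_forall fun z => ?_)
          dsimp only
          rw [← sum_mul]
          congr 1
          rw [← Fintype.piFinset_univ,
            sum_prod_piFinset univ fun (_ : Fin n) (x : Fin d) => cubeMean z ^ (x : ℕ) / (n : ℝ),
            prod_const, card_univ, Fintype.card_fin, ← sum_div,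
            Fin.sum_univ_eq_sum_range fun i => cubeMean z ^ i]
        · intro k _
          exact integrable_cube (by fun_prop)
  have hunion : (#{ω : CandidateListSample m n d | ω.toInstance.HasPerfectStableMatching} : ℝ) ≤
      ∑ μ : Fin n ↪ Fin m, ∑ k : Fin n → Fin d,
        (#{ω : CandidateListSample m n d | IsStableWitness ω μ k} : ℝ) := by
    have hsub : ({ω : CandidateListSample m n d | ω.toInstance.HasPerfectStableMatching} :
        Finset _) ⊆ univ.biUnion fun μ : Fin n ↪ Fin m => univ.biUnion fun k : Fin n → Fin d =>
          {ω : CandidateListSample m n d | IsStableWitness ω μ k} := by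
      intro ω hω
      simpa using exists_isStableWitness ω (by simpa using hω)
    have h := (card_le_card hsub).trans (card_biUnion_le.trans
      (sum_le_sum fun μ _ => card_biUnion_le))
    exact_mod_cast h
  rw [hmeas, div_le_iff₀ (by positivity)]
  refine (hunion.trans hsum).trans_eq ?_
  rw [div_pow]
  field_simp

theorem one_sub_le_measure_not_hasPerfectStableMatching {m n d : ℕ} (hd : d ≤ n) :
    1 - (candidateListLaw m n d).real {ω | ω.toInstance.HasPerfectStableMatching} ≤
      (candidateListLaw m n d).real {ω | ¬ ω.toInstance.HasPerfectStableMatching} := by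
  have : Nonempty (CandidateListSample m n d) := ⟨(fun _ => Fin.castLEEmb hd, fun _ => 1)⟩
  have : IsProbabilityMeasure (candidateListLaw m n d) :=
    ProbabilityTheory.isProbabilityMeasure_uniformOn Set.finite_univ Set.univ_nonempty
  have h := probReal_compl_eq_one_sub (μ := candidateListLaw m n d)
    (s := {ω | ω.toInstance.HasPerfectStableMatching}) (MeasurableSet.of_discrete)
  exact h.ge

/-! ### Estimating the integral -/

theorem factorial_mul_exp_le {n : ℕ} (hn : 0 < n) :
    (n ! : ℝ) * Real.exp n ≤ Real.exp 1 * n * (n : ℝ) ^ n := by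
  obtain ⟨k, rfl⟩ := Nat.exists_eq_succ_of_ne_zero hn.ne'
  have h : Stirling.stirlingSeq (k + 1) ≤ Real.exp 1 / √2 := by
    have := Stirling.stirlingSeq'_antitone (Nat.zero_le k)
    simpa [Stirling.stirlingSeq_one] using this
  have hpos : (0 : ℝ) < (k + 1 : ℕ) := by positivity
  have h2 : (0 : ℝ) < √2 := by positivity
  rw [Stirling.stirlingSeq, div_le_div_iff₀ (by positivity) h2, Real.sqrt_mul zero_le_two,
    div_pow, ← Real.exp_nat_mul, mul_one] at h
  have h3 : ((k + 1)! : ℝ) * Real.exp (k + 1 : ℕ) ≤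
      Real.exp 1 * √(k + 1 : ℕ) * ((k + 1 : ℕ) : ℝ) ^ (k + 1) := by
    have he : (0 : ℝ) < Real.exp (k + 1 : ℕ) := Real.exp_pos _
    refine le_of_mul_le_mul_right ?_ h2
    calc ((k + 1)! : ℝ) * Real.exp (k + 1 : ℕ) * √2
        = ((k + 1)! : ℝ) * √2 * Real.exp (k + 1 : ℕ) := by ring
      _ ≤ Real.exp 1 * (√2 * √(k + 1 : ℕ) *
          (((k + 1 : ℕ) : ℝ) ^ (k + 1) / Real.exp (k + 1 : ℕ))) * Real.exp (k + 1 : ℕ) :=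
          mul_le_mul_of_nonneg_right h he.le
      _ = _ := by field_simp
  refine h3.trans ?_
  gcongr
  rw [Real.sqrt_le_left hpos.le]
  have : (1 : ℝ) ≤ (k + 1 : ℕ) := by exact_mod_cast Nat.succ_pos k
  nlinarith

theorem exp_neg_add_sq_le {x : ℝ} (h0 : 0 ≤ x) (h1 : x ≤ 1 / 2) :
    Real.exp (-(x + x ^ 2)) ≤ 1 - x := by
  have ht : 0 ≤ x + x ^ 2 := by positivity
  have h := Real.quadratic_le_exp_of_nonneg ht
  rw [Real.exp_neg, inv_le_comm₀ (Real.exp_pos _) (by linarith),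
    inv_le_iff_one_le_mul₀ (by linarith)]
  refine le_trans ?_ (mul_le_mul_of_nonneg_right h (by linarith))
  have h2 : 0 ≤ 1 - x - x ^ 2 - x ^ 3 := by
    nlinarith [mul_nonneg h0 h0, mul_nonneg h0 (mul_nonneg h0 h0)]
  nlinarith [mul_nonneg (sq_nonneg x) h2]

theorem choose_mul_pow_le_add_pow {m n : ℕ} (hnm : n ≤ m) {x y : ℝ} (hx : 0 ≤ x) (hy : 0 ≤ y) :
    (m.choose n : ℝ) * (x ^ n * y ^ (m - n)) ≤ (x + y) ^ m := by
  rw [add_pow, mul_comm]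
  exact single_le_sum (f := fun i => x ^ i * y ^ (m - i) * (m.choose i : ℝ))
    (fun i _ => by positivity) (mem_range.2 (Nat.lt_succ_of_le hnm))

/-- Chernoff's bound for one binomial probability in the lower tail. -/
theorem choose_mul_pow_le_exp {m n : ℕ} (hnm : n ≤ m) {Q η : ℝ} (hQ0 : 0 ≤ Q) (hQ1 : Q ≤ 1)
    (hη0 : 0 ≤ η) (hη1 : η ≤ 1) (h : (1 + η) * ((m : ℝ) - n) ≤ m * Q) :
    (m.choose n : ℝ) * ((1 - Q) ^ n * Q ^ (m - n)) ≤ Real.exp (-(m * Q * η ^ 2 / 8)) := by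
  set θ := η / 2 with hθ
  have hk : ((m - n : ℕ) : ℝ) = (m : ℝ) - n := Nat.cast_sub hnm
  have hexp := exp_neg_add_sq_le (x := θ) (by linarith) (by linarith)
  have h1 := choose_mul_pow_le_add_pow hnm (x := 1 - Q) (y := Q * (1 - θ)) (by linarith)
    (mul_nonneg hQ0 (by linarith))
  have h2 : (1 - Q + Q * (1 - θ)) ^ m ≤ Real.exp (-(m * (Q * θ))) := by
    have : 1 - Q + Q * (1 - θ) ≤ Real.exp (-(Q * θ)) := by
      have := Real.add_one_le_exp (-(Q * θ))
      linarith
    calc _ ≤ Real.exp (-(Q * θ)) ^ m :=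
          pow_le_pow_left₀ (add_nonneg (by linarith) (mul_nonneg hQ0 (by linarith))) this m
      _ = _ := by rw [← Real.exp_nat_mul]; ring_nf
  have h3 : Real.exp (-(((m - n : ℕ) : ℝ) * (θ + θ ^ 2))) ≤ (1 - θ) ^ (m - n) := by
    calc _ = Real.exp (-(θ + θ ^ 2)) ^ (m - n) := by rw [← Real.exp_nat_mul]; ring_nf
      _ ≤ _ := pow_le_pow_left₀ (Real.exp_pos _).le hexp _
  have hC : (0 : ℝ) ≤ (m.choose n : ℝ) * ((1 - Q) ^ n * Q ^ (m - n)) := by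
    have : 0 ≤ 1 - Q := by linarith
    positivity
  have h4 : (m.choose n : ℝ) * ((1 - Q) ^ n * Q ^ (m - n)) *
      Real.exp (-(((m - n : ℕ) : ℝ) * (θ + θ ^ 2))) ≤ Real.exp (-(m * (Q * θ))) := by
    refine (mul_le_mul_of_nonneg_left h3 hC).trans (le_trans (le_of_eq ?_) (h1.trans h2))
    rw [mul_pow]
    ring
  rw [Real.exp_neg (_ * _), ← div_eq_mul_inv, div_le_iff₀ (Real.exp_pos _), ← Real.exp_add] at h4
  refine h4.trans (Real.exp_le_exp.2 ?_)
  rw [hk]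
  have hmQ : 0 ≤ (m : ℝ) * Q := by positivity
  have h5 : ((m : ℝ) - n) * (θ + θ ^ 2) ≤ m * Q * (θ - θ * η / 4) := by
    have e : θ + θ ^ 2 ≤ (1 + η) * (θ - θ * η / 4) := by
      rw [hθ]
      nlinarith [mul_nonneg hη0 hη0, mul_nonneg hη0 (mul_nonneg hη0 hη0)]
    have hk0 : 0 ≤ (m : ℝ) - n := by rw [← hk]; positivity
    have hw : 0 ≤ θ - θ * η / 4 := by rw [hθ]; nlinarith
    calc ((m : ℝ) - n) * (θ + θ ^ 2) ≤ ((m : ℝ) - n) * ((1 + η) * (θ - θ * η / 4)) :=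
          mul_le_mul_of_nonneg_left e hk0
      _ = (1 + η) * ((m : ℝ) - n) * (θ - θ * η / 4) := by ring
      _ ≤ _ := mul_le_mul_of_nonneg_right h hw
  have h6 : m * Q * (θ * η / 4) = m * Q * η ^ 2 / 8 := by rw [hθ]; ring
  nlinarith

theorem integral_cube_exp {n : ℕ} {u : ℝ} (hu : 0 < u) :
    ∫ z : Fin n → unitInterval, Real.exp (-(u * (n - ∑ j, (z j : ℝ)))) =
      ((1 - Real.exp (-u)) / u) ^ n := by
  have h1 : ∀ z : Fin n → unitInterval, Real.exp (-(u * (n - ∑ j, (z j : ℝ)))) =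
      ∏ j, Real.exp (u * (z j : ℝ) - u) := by
    intro z
    rw [← Real.exp_sum, sum_sub_distrib, ← mul_sum, sum_const, card_univ, Fintype.card_fin,
      nsmul_eq_mul]
    ring_nf
  have h2 : ∫ x : unitInterval, Real.exp (u * (x : ℝ) - u) = (1 - Real.exp (-u)) / u := by
    have h := integral_subtype (G := ℝ) (s := unitInterval) measurableSet_Icc
      (fun x : ℝ => Real.exp (u * x - u))
    refine h.trans ?_
    rw [unitInterval, integral_Icc_eq_integral_Ioc,
      ← intervalIntegral.integral_of_le zero_le_one,
      intervalIntegral.integral_comp_mul_sub (fun x => Real.exp x) hu.ne', integral_exp]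
    simp [div_eq_inv_mul]
  simp_rw [h1]
  rw [integral_fintype_prod_volume_eq_prod
    (fun (_ : Fin n) (x : unitInterval) => Real.exp (u * (x : ℝ) - u)), h2, prod_const, card_univ,
    Fintype.card_fin]

/-- The integrand is `s⁻ⁿ`, with `s = n (1 - q)`, times a binomial probability. On the grid of
rates `u = i / n`, the rate next above `n / s` has `s⁻ⁿ ≤ (u / n)ⁿ exp (n + 1 - u s)`. The last
summand takes care of the singularity at `s = 0`. -/
theorem momentIntegrand_le {n m d : ℕ} (hn : 0 < n) (hd : 0 < d) (hnm : n ≤ m) (hm : m ≤ 2 * n)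
    {s₀ β : ℝ} (hs₀ : 0 < s₀) (hβ : 0 ≤ β)
    (hbin : ∀ s : ℝ, 0 ≤ s → s ≤ n → s ≤ s₀ → (m.choose n : ℝ) *
      ((1 - (1 - s / n) ^ d) ^ n * ((1 - s / n) ^ d) ^ (m - n)) ≤ β)
    {s : ℝ} (hs : 0 ≤ s) (hsn : s ≤ n) :
    m.descFactorial n * momentIntegrand n m d (1 - s / n) ≤
      ∑ i ∈ Icc 1 (100 * d * n), (n ! : ℝ) * ((i / n : ℝ) / n) ^ n * Real.exp (n + 1) *
        (if (i / n : ℝ) ≤ n / s₀ + 1 / n then 1 else β) * Real.exp (-((i / n : ℝ) * s)) +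
      (n ! : ℝ) * 4 ^ n * (d / n : ℝ) ^ n * Real.exp n * Real.exp (-((100 * d : ℝ) * s)) := by
  have hn' : (0 : ℝ) < n := by positivity
  have hd' : (0 : ℝ) < d := by positivity
  have hn1 : (1 : ℝ) ≤ n := by exact_mod_cast hn
  have hq0 : 0 ≤ 1 - s / n := by
    rw [sub_nonneg, div_le_one hn']
    exact hsn
  have hq1 : 1 - s / n ≤ 1 := by
    have : 0 ≤ s / n := by positivity
    linarith
  set q := 1 - s / n with hq
  have hterm : ∀ i ∈ Icc 1 (100 * d * n), 0 ≤ (n ! : ℝ) * ((i / n : ℝ) / n) ^ n *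
      Real.exp (n + 1) * (if (i / n : ℝ) ≤ n / s₀ + 1 / n then 1 else β) *
        Real.exp (-((i / n : ℝ) * s)) := by
    intro i _
    have : (0 : ℝ) ≤ if (i / n : ℝ) ≤ n / s₀ + 1 / n then 1 else β := by
      split_ifs
      · exact zero_le_one
      · exact hβ
    positivity
  have hfac : (m.descFactorial n : ℝ) = n ! * m.choose n := by
    exact_mod_cast Nat.descFactorial_eq_factorial_mul_choose m n
  unfold momentIntegrand
  rcases lt_or_ge s (n / (100 * d)) with hsmall | hlarge
  · refine le_trans ?_ (le_add_of_nonneg_left (sum_nonneg hterm))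
    have h1 : (∑ k ∈ range d, q ^ k) / n ≤ d / n := by
      gcongr
      calc ∑ k ∈ range d, q ^ k ≤ ∑ _k ∈ range d, (1 : ℝ) :=
            sum_le_sum fun k _ => pow_le_one₀ hq0 hq1
        _ = d := by simp
    have h2 : (q ^ d) ^ (m - n) ≤ 1 := pow_le_one₀ (by positivity) (pow_le_one₀ hq0 hq1)
    have h3 : (m.choose n : ℝ) ≤ 4 ^ n := by
      have : m.choose n ≤ 4 ^ n := calc
        m.choose n ≤ 2 ^ m := Nat.choose_le_two_pow m n
        _ ≤ 2 ^ (2 * n) := Nat.pow_le_pow_right (by norm_num) hm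
        _ = 4 ^ n := by rw [pow_mul]; norm_num
      exact_mod_cast this
    have h4 : 1 ≤ Real.exp n * Real.exp (-((100 * d : ℝ) * s)) := by
      rw [← Real.exp_add]
      refine Real.one_le_exp ?_
      rw [lt_div_iff₀ (by positivity)] at hsmall
      linarith
    have h5 : 0 ≤ (∑ k ∈ range d, q ^ k) / n := by positivity
    calc _ ≤ (n ! : ℝ) * 4 ^ n * ((d / n : ℝ) ^ n * 1) := by
          rw [hfac]
          gcongr
      _ = (n ! : ℝ) * 4 ^ n * (d / n : ℝ) ^ n * 1 := by ring
      _ ≤ (n ! : ℝ) * 4 ^ n * (d / n : ℝ) ^ n * (Real.exp n * Real.exp (-((100 * d : ℝ) * s))) :=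
          mul_le_mul_of_nonneg_left h4 (by positivity)
      _ = _ := by ring
  · have hs' : 0 < s := lt_of_lt_of_le (by positivity) hlarge
    set i := ⌈(n : ℝ) ^ 2 / s⌉₊ with hi
    have hi0 : 1 ≤ i := Nat.ceil_pos.2 (by positivity)
    have hiM : i ≤ 100 * d * n := by
      rw [hi, Nat.ceil_le]
      push_cast
      rw [div_le_iff₀ (by positivity)] at hlarge
      rw [div_le_iff₀ hs']
      nlinarith
    have hu1 : (n : ℝ) / s ≤ i / n := by
      rw [le_div_iff₀ hn']
      calc (n : ℝ) / s * n = (n : ℝ) ^ 2 / s := by ring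
        _ ≤ i := Nat.le_ceil _
    have hu2 : (i / n : ℝ) ≤ n / s + 1 / n := by
      rw [div_le_iff₀ hn']
      calc (i : ℝ) ≤ (n : ℝ) ^ 2 / s + 1 := (Nat.ceil_lt_add_one (by positivity)).le
        _ = _ := by field_simp
    refine le_trans ?_ (le_add_of_nonneg_right (by positivity))
    refine le_trans ?_ (single_le_sum (f := fun i : ℕ => (n ! : ℝ) * ((i / n : ℝ) / n) ^ n *
      Real.exp (n + 1) * (if (i / n : ℝ) ≤ n / s₀ + 1 / n then 1 else β) *
        Real.exp (-((i / n : ℝ) * s))) hterm (mem_Icc.2 ⟨hi0, hiM⟩))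
    have hgeom : (∑ k ∈ range d, q ^ k) / n = (1 - q ^ d) * s⁻¹ := by
      have := geom_sum_mul_neg q d
      rw [← this, hq]
      field_simp
      ring
    have hQ0 : 0 ≤ q ^ d := by positivity
    have hQ1 : 0 ≤ 1 - q ^ d := sub_nonneg.2 (pow_le_one₀ hq0 hq1)
    have hB : (m.choose n : ℝ) * ((1 - q ^ d) ^ n * (q ^ d) ^ (m - n)) ≤
        if (i / n : ℝ) ≤ n / s₀ + 1 / n then 1 else β := by
      split_ifs with hc
      · refine (choose_mul_pow_le_add_pow hnm hQ1 hQ0).trans_eq ?_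
        simp
      · refine hbin s hs hsn ?_
        by_contra hlt
        push Not at hlt hc
        have : (n : ℝ) / s ≤ n / s₀ := by gcongr
        linarith
    have hS : (s⁻¹) ^ n ≤ ((i / n : ℝ) / n) ^ n := by
      refine pow_le_pow_left₀ (by positivity) ?_ n
      rw [le_div_iff₀ hn']
      calc s⁻¹ * n = n / s := by ring
        _ ≤ _ := hu1
    have hE : 1 ≤ Real.exp (n + 1) * Real.exp (-((i / n : ℝ) * s)) := by
      rw [← Real.exp_add]
      refine Real.one_le_exp ?_
      have : (i / n : ℝ) * s ≤ (n / s + 1 / n) * s := by gcongr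
      have h7 : (n / s + 1 / n) * s = n + s / n := by field_simp
      have h8 : s / n ≤ 1 := (div_le_one hn').2 hsn
      linarith
    have hB0 : 0 ≤ (m.choose n : ℝ) * ((1 - q ^ d) ^ n * (q ^ d) ^ (m - n)) := by positivity
    calc _ = (n ! : ℝ) * ((m.choose n : ℝ) * ((1 - q ^ d) ^ n * (q ^ d) ^ (m - n))) *
          (s⁻¹) ^ n * 1 := by
          rw [hfac, hgeom, mul_pow]
          ring
      _ ≤ (n ! : ℝ) * (if (i / n : ℝ) ≤ n / s₀ + 1 / n then 1 else β) * ((i / n : ℝ) / n) ^ n *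
          (Real.exp (n + 1) * Real.exp (-((i / n : ℝ) * s))) := by
          have := hB0.trans hB
          gcongr
      _ = _ := by ring

theorem integral_momentIntegrand_le {n m d : ℕ} (hn : 0 < n) (hd : 0 < d) (hnm : n ≤ m)
    (hm : m ≤ 2 * n) {s₀ β : ℝ} (hs₀ : 0 < s₀) (hβ : 0 ≤ β)
    (hbin : ∀ s : ℝ, 0 ≤ s → s ≤ n → s ≤ s₀ → (m.choose n : ℝ) *
      ((1 - (1 - s / n) ^ d) ^ n * ((1 - s / n) ^ d) ^ (m - n)) ≤ β) :
    m.descFactorial n * ∫ z : Fin n → unitInterval, momentIntegrand n m d (cubeMean z) ≤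
      100 * d * n * (Real.exp 2 * n * (β + Real.exp (-(n * Real.exp (-(n / s₀ + 1 / n)))))) +
        Real.exp 1 * n * (1 / 25) ^ n := by
  have hn' : (0 : ℝ) < n := by positivity
  have hd' : (0 : ℝ) < d := by positivity
  have hfact := factorial_mul_exp_le hn
  have hmean : ∀ z : Fin n → unitInterval, cubeMean z = 1 - (n - ∑ j, (z j : ℝ)) / n := by
    intro z
    rw [cubeMean]
    field_simp
    ring
  have hpt : ∀ z : Fin n → unitInterval,
      m.descFactorial n * momentIntegrand n m d (cubeMean z) ≤
      ∑ i ∈ Icc 1 (100 * d * n), (n ! : ℝ) * ((i / n : ℝ) / n) ^ n * Real.exp (n + 1) *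
        (if (i / n : ℝ) ≤ n / s₀ + 1 / n then 1 else β) *
          Real.exp (-((i / n : ℝ) * (n - ∑ j, (z j : ℝ)))) +
      (n ! : ℝ) * 4 ^ n * (d / n : ℝ) ^ n * Real.exp n *
        Real.exp (-((100 * d : ℝ) * (n - ∑ j, (z j : ℝ)))) := by
    intro z
    rw [hmean]
    refine momentIntegrand_le hn hd hnm hm hs₀ hβ hbin ?_ ?_
    · rw [sub_nonneg]
      calc ∑ j, (z j : ℝ) ≤ ∑ _j : Fin n, (1 : ℝ) := sum_le_sum fun j _ => (z j).2.2
        _ = n := by simp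
    · have : 0 ≤ ∑ j, (z j : ℝ) := sum_nonneg fun j _ => (z j).2.1
      linarith
  have hint : ∀ u : ℝ, Integrable fun z : Fin n → unitInterval =>
      Real.exp (-(u * (n - ∑ j, (z j : ℝ)))) := fun u => integrable_cube (by fun_prop)
  have hterm : ∀ i ∈ Icc 1 (100 * d * n), (n ! : ℝ) * ((i / n : ℝ) / n) ^ n * Real.exp (n + 1) *
      (if (i / n : ℝ) ≤ n / s₀ + 1 / n then 1 else β) *
        ((1 - Real.exp (-(i / n : ℝ))) / (i / n : ℝ)) ^ n ≤
        Real.exp 2 * n * (β + Real.exp (-(n * Real.exp (-(n / s₀ + 1 / n))))) := by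
    intro i hi
    have hi' : (0 : ℝ) < i := by exact_mod_cast (mem_Icc.1 hi).1
    have hu : (0 : ℝ) < i / n := by positivity
    set u : ℝ := i / n with hu_def
    have hv0 : 0 ≤ 1 - Real.exp (-u) := sub_nonneg.2 (Real.exp_le_one_iff.2 (by linarith))
    have hv1 : 1 - Real.exp (-u) ≤ 1 := by linarith [Real.exp_pos (-u)]
    have hkey : (if u ≤ n / s₀ + 1 / n then 1 else β) * (1 - Real.exp (-u)) ^ n ≤
        β + Real.exp (-(n * Real.exp (-(n / s₀ + 1 / n)))) := by
      split_ifs with hc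
      · have h1 : 1 - Real.exp (-u) ≤ Real.exp (-Real.exp (-(n / s₀ + 1 / n))) := by
          have h2 := Real.add_one_le_exp (-Real.exp (-(n / s₀ + 1 / n)))
          have h3 : Real.exp (-(n / s₀ + 1 / n)) ≤ Real.exp (-u) :=
            Real.exp_le_exp.2 (neg_le_neg hc)
          linarith
        have h4 := pow_le_pow_left₀ hv0 h1 n
        rw [← Real.exp_nat_mul, mul_neg] at h4
        linarith
      · have := mul_le_of_le_one_right hβ (pow_le_one₀ hv0 hv1 (n := n))
        linarith [Real.exp_pos (-(n * Real.exp (-(n / s₀ + 1 / n))))]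
    have hcoef : (n ! : ℝ) * Real.exp (n + 1) / (n : ℝ) ^ n ≤ Real.exp 2 * n := by
      rw [div_le_iff₀ (by positivity), Real.exp_add, show (2 : ℝ) = 1 + 1 by norm_num,
        Real.exp_add]
      nlinarith [Real.exp_pos 1, mul_le_mul_of_nonneg_right hfact (Real.exp_pos 1).le]
    have hnn : 0 ≤ (if u ≤ n / s₀ + 1 / n then 1 else β) * (1 - Real.exp (-u)) ^ n := by
      refine mul_nonneg ?_ (by positivity)
      split_ifs
      · exact zero_le_one
      · exact hβ
    calc _ = (n ! : ℝ) * Real.exp (n + 1) / (n : ℝ) ^ n *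
          ((if u ≤ n / s₀ + 1 / n then 1 else β) * (1 - Real.exp (-u)) ^ n) := by
          generalize (if u ≤ n / s₀ + 1 / n then (1 : ℝ) else β) = b
          rw [div_pow u, div_pow (1 - _)]
          field_simp
      _ ≤ _ := mul_le_mul hcoef hkey hnn (by positivity)
  have hlast : (n ! : ℝ) * 4 ^ n * (d / n : ℝ) ^ n * Real.exp n *
      ((1 - Real.exp (-(100 * d : ℝ))) / (100 * d : ℝ)) ^ n ≤ Real.exp 1 * n * (1 / 25) ^ n := by
    have hv0 : 0 ≤ 1 - Real.exp (-(100 * d : ℝ)) :=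
      sub_nonneg.2 (Real.exp_le_one_iff.2 (by linarith))
    have hv1 : 1 - Real.exp (-(100 * d : ℝ)) ≤ 1 := by linarith [Real.exp_pos (-(100 * d : ℝ))]
    have hpow : 4 ^ n * (d / n : ℝ) ^ n * (1 / (100 * d : ℝ)) ^ n =
        (1 / 25) ^ n / (n : ℝ) ^ n := by
      rw [← mul_pow, ← mul_pow, ← div_pow]
      congr 1
      field_simp
      norm_num
    calc _ ≤ (n ! : ℝ) * 4 ^ n * (d / n : ℝ) ^ n * Real.exp n * (1 / (100 * d : ℝ)) ^ n := by
          gcongr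
      _ = (n ! : ℝ) * Real.exp n * (4 ^ n * (d / n : ℝ) ^ n * (1 / (100 * d : ℝ)) ^ n) := by ring
      _ ≤ Real.exp 1 * n * (n : ℝ) ^ n * ((1 / 25) ^ n / (n : ℝ) ^ n) := by
          rw [hpow]
          gcongr
      _ = _ := by field_simp
  have hcont := continuous_cubeMean (n := n)
  rw [← integral_const_mul]
  calc _ ≤ ∫ z : Fin n → unitInterval,
      (∑ i ∈ Icc 1 (100 * d * n), (n ! : ℝ) * ((i / n : ℝ) / n) ^ n * Real.exp (n + 1) *
        (if (i / n : ℝ) ≤ n / s₀ + 1 / n then 1 else β) *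
          Real.exp (-((i / n : ℝ) * (n - ∑ j, (z j : ℝ)))) +
      (n ! : ℝ) * 4 ^ n * (d / n : ℝ) ^ n * Real.exp n *
        Real.exp (-((100 * d : ℝ) * (n - ∑ j, (z j : ℝ))))) := by
        refine integral_mono ?_ ?_ hpt
        · unfold momentIntegrand
          exact integrable_cube (by fun_prop)
        · exact integrable_cube (by fun_prop)
    _ = ∑ i ∈ Icc 1 (100 * d * n), (n ! : ℝ) * ((i / n : ℝ) / n) ^ n * Real.exp (n + 1) *
        (if (i / n : ℝ) ≤ n / s₀ + 1 / n then 1 else β) *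
          ((1 - Real.exp (-(i / n : ℝ))) / (i / n : ℝ)) ^ n +
      (n ! : ℝ) * 4 ^ n * (d / n : ℝ) ^ n * Real.exp n *
        ((1 - Real.exp (-(100 * d : ℝ))) / (100 * d : ℝ)) ^ n := by
        rw [integral_add (integrable_finsetSum _ fun i _ => (hint _).const_mul _)
          ((hint _).const_mul _), integral_finsetSum _ fun i _ => (hint _).const_mul _,
          integral_const_mul, integral_cube_exp (by positivity : (0 : ℝ) < 100 * d)]
        congr 1
        refine sum_congr rfl fun i hi => ?_
        have hi' : (0 : ℝ) < i := by exact_mod_cast (mem_Icc.1 hi).1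
        rw [integral_const_mul, integral_cube_exp (by positivity)]
    _ ≤ _ := by
        refine add_le_add ((sum_le_sum hterm).trans_eq ?_) hlast
        rw [sum_const, Nat.card_Icc, nsmul_eq_mul]
        push_cast
        simp

/-! ### The asymptotics below the threshold -/

/-- The price of dropping the distinctness of the entries of the `m` lists is negligible against
`exp (-n ^ ε)`, as `d` is of order `(log n) ^ 2`. -/
theorem pow_div_descFactorial_pow_le {n m d : ℕ} (hd : 2 * d ≤ n) (hn : 0 < n) (hm : m ≤ 2 * n) :
    ((n : ℝ) ^ d / n.descFactorial d) ^ m ≤ Real.exp (4 * (d : ℝ) ^ 2) := by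
  have hn' : (0 : ℝ) < n := by positivity
  have hd' : 2 * (d : ℝ) ≤ n := by exact_mod_cast hd
  have hm' : (m : ℝ) ≤ 2 * n := by exact_mod_cast hm
  have hdn : d ≤ n := by omega
  have hpos : (0 : ℝ) < n - d := by linarith
  have h1 : ((n : ℝ) - d) ^ d ≤ n.descFactorial d := by
    have h := (Nat.pow_le_pow_left (by omega : n - d ≤ n + 1 - d) d).trans
      (Nat.pow_sub_le_descFactorial n d)
    rw [← Nat.cast_sub hdn]
    exact_mod_cast h
  have h2 : (n : ℝ) / (n - d) ≤ Real.exp (2 * d / n) := by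
    refine le_trans ?_ (Real.add_one_le_exp _)
    rw [div_le_iff₀ hpos]
    have : (2 * (d : ℝ) / n + 1) * (n - d) = n + d * (n - 2 * d) / n := by field_simp; ring
    rw [this]
    have : 0 ≤ (d : ℝ) * (n - 2 * d) / n := by
      have : 0 ≤ (n : ℝ) - 2 * d := by linarith
      positivity
    linarith
  have h3 : (n : ℝ) ^ d / n.descFactorial d ≤ Real.exp (2 * d / n) ^ d := by
    calc (n : ℝ) ^ d / n.descFactorial d ≤ (n : ℝ) ^ d / (n - d) ^ d := by gcongr
      _ = (n / (n - d)) ^ d := by rw [div_pow]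
      _ ≤ _ := by gcongr
  calc _ ≤ (Real.exp (2 * d / n) ^ d) ^ m := by gcongr
    _ = Real.exp (m * (d * (2 * d / n))) := by rw [← Real.exp_nat_mul, ← Real.exp_nat_mul]
    _ ≤ _ := by
      refine Real.exp_le_exp.2 ?_
      calc (m : ℝ) * (d * (2 * d / n)) ≤ 2 * n * (d * (2 * d / n)) := by gcongr
        _ = _ := by field_simp; ring

/-- The logarithmic factor of the threshold, `log (1 / p)` with `p = 1 - n / m + n / m ^ 2`. -/
theorem log_threshold_bounds {n m : ℕ} {α : ℝ} (hn : 10 ≤ n) (hα : 0 ≤ α)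
    (hα1 : α + 1 / n < 1) (hm : (m : ℝ) = n * (1 + α)) {L : ℝ}
    (hL : L = Real.log ((1 + α) / (α + 1 / (n * (1 + α))))) :
    1 / 2 ≤ L ∧ L ≤ Real.log (4 * n) ∧ (m : ℝ) - n ≤ m * Real.exp (-L) := by
  have hn' : (10 : ℝ) ≤ n := by exact_mod_cast hn
  have hn0 : (0 : ℝ) < n := by linarith
  have hα2 : α < 1 := by
    have : 0 < 1 / (n : ℝ) := by positivity
    linarith
  have h1α : 0 < 1 + α := by linarith
  have hden : 0 < α + 1 / (n * (1 + α)) := by positivity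
  have hexp : Real.exp (-L) = (α + 1 / (n * (1 + α))) / (1 + α) := by
    rw [hL, Real.exp_neg, Real.exp_log (by positivity), inv_div]
  refine ⟨?_, ?_, ?_⟩
  · rw [hL, Real.le_log_iff_exp_le (by positivity), le_div_iff₀ hden]
    have he : Real.exp (1 / 2) ≤ 5 / 3 := by
      have h2 : Real.exp (1 / 2) * Real.exp (1 / 2) = Real.exp 1 := by
        rw [← Real.exp_add]
        norm_num
      nlinarith [Real.exp_one_lt_d9, Real.exp_pos (1 / 2)]
    refine (mul_le_mul_of_nonneg_right he hden.le).trans ?_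
    have h3 : 1 / (n * (1 + α)) ≤ 1 / (n : ℝ) :=
      one_div_le_one_div_of_le hn0 (by nlinarith)
    have h4 : 1 / (n : ℝ) ≤ 1 / 10 := one_div_le_one_div_of_le (by norm_num) hn'
    rcases le_or_gt α (9 / 10) with h5 | h5
    · nlinarith
    · linarith
  · rw [hL]
    refine Real.log_le_log (by positivity) ?_
    rw [div_le_iff₀ hden]
    have h3 : 4 * n * (α + 1 / (n * (1 + α))) = 4 * n * α + 4 / (1 + α) := by field_simp
    have h4 : 1 + α ≤ 4 / (1 + α) := by
      rw [le_div_iff₀ h1α]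
      nlinarith
    rw [h3]
    have : 0 ≤ 4 * n * α := by positivity
    linarith
  · have : (m : ℝ) * Real.exp (-L) = n * α + 1 / (1 + α) := by
      rw [hexp, hm]
      field_simp
    rw [this, hm]
    have : 0 < 1 / (1 + α) := by positivity
    linarith

/-- Below the threshold, a rejection rate `1 - s / n` with `s ≤ n / ((1 - γ / 2) log n)` leaves
more unmatched candidates than a perfect matching allows: the expected number `m Q` exceeds
`m - n` by the factor `1 + γ / 8`. -/
theorem choose_mul_rejection_le {n m d : ℕ} {γ L : ℝ} (hn : 0 < n) (hnm : n ≤ m) (hγ0 : 0 < γ)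
    (hγ1 : γ < 1) (hlog : 8 / γ ≤ Real.log n) (hL0 : 1 / 2 ≤ L) (hL1 : L ≤ Real.log (4 * n))
    (hmL : (m : ℝ) - n ≤ m * Real.exp (-L)) (hd : (d : ℝ) < (1 - γ) * Real.log n * L)
    {s : ℝ} (hs : 0 ≤ s) (hs₀ : s ≤ n / ((1 - γ / 2) * Real.log n)) :
    (m.choose n : ℝ) * ((1 - (1 - s / n) ^ d) ^ n * ((1 - s / n) ^ d) ^ (m - n)) ≤
      Real.exp (-(γ ^ 2 / 2048 * (n : ℝ) ^ (γ / 4))) := by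
  have hn' : (0 : ℝ) < n := by positivity
  have hlog0 : 0 < Real.log n := lt_of_lt_of_le (by positivity) hlog
  have hγ2 : 0 < 1 - γ / 2 := by linarith
  set x := s / n with hx
  have hx0 : 0 ≤ x := by positivity
  have hx1 : x * ((1 - γ / 2) * Real.log n) ≤ 1 := by
    rw [le_div_iff₀ (by positivity)] at hs₀
    rw [hx, div_mul_eq_mul_div, div_le_one hn']
    exact hs₀
  have hlogγ : 8 ≤ γ * Real.log n := by
    rw [div_le_iff₀ hγ0] at hlog
    linarith
  have hx2 : x ≤ γ / 4 := by
    have : x * (4 / γ) ≤ 1 := by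
      refine le_trans (mul_le_mul_of_nonneg_left ?_ hx0) hx1
      rw [div_le_iff₀ hγ0]
      nlinarith
    rw [mul_div_assoc', div_le_one hγ0] at this
    linarith
  set Q := (1 - x) ^ d with hQ
  have hQ0 : 0 ≤ Q := pow_nonneg (by linarith) _
  have hQ1 : Q ≤ 1 := pow_le_one₀ (by linarith) (by linarith)
  have hexpo : d * (x + x ^ 2) ≤ (1 - γ / 4) * L := by
    have hγ' : (1 - γ) ≤ (1 - γ / 2) * (1 - γ / 2) := by nlinarith
    calc d * (x + x ^ 2) ≤ (1 - γ) * Real.log n * L * (x + x ^ 2) := by gcongr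
      _ ≤ (1 - γ / 2) * (1 - γ / 2) * Real.log n * L * (x + x ^ 2) := by gcongr
      _ = (x * ((1 - γ / 2) * Real.log n)) * ((1 - γ / 2) * (1 + x) * L) := by ring
      _ ≤ 1 * ((1 - γ / 2) * (1 + x) * L) := by gcongr
      _ ≤ (1 - γ / 4) * L := by
        rw [one_mul]
        gcongr
        nlinarith
  have hQL : Real.exp (-((1 - γ / 4) * L)) ≤ Q := by
    calc _ ≤ Real.exp (-(d * (x + x ^ 2))) := Real.exp_le_exp.2 (neg_le_neg hexpo)
      _ = Real.exp (-(x + x ^ 2)) ^ d := by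
        rw [← Real.exp_nat_mul]
        ring_nf
      _ ≤ Q := pow_le_pow_left₀ (Real.exp_pos _).le (exp_neg_add_sq_le hx0 (by linarith)) d
  have hexcess : (1 + γ / 8) * ((m : ℝ) - n) ≤ m * Q := by
    have h1 : 1 + γ / 8 ≤ Real.exp (γ / 4 * L) := by
      have := Real.add_one_le_exp (γ / 4 * L)
      nlinarith
    have hmn : (0 : ℝ) ≤ (m : ℝ) - n := sub_nonneg.2 (by exact_mod_cast hnm)
    calc (1 + γ / 8) * ((m : ℝ) - n) ≤ Real.exp (γ / 4 * L) * (m * Real.exp (-L)) := by gcongr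
      _ = m * Real.exp (-((1 - γ / 4) * L)) := by
        rw [mul_left_comm, ← Real.exp_add]
        ring_nf
      _ ≤ m * Q := by gcongr
  have hmQ : (n : ℝ) ^ (γ / 4) / 4 ≤ m * Q := by
    have hnm' : (n : ℝ) ≤ m := by exact_mod_cast hnm
    have h1 : (n : ℝ) ^ (γ / 4) / (4 * n) ≤ Q := by
      refine le_trans ?_ hQL
      have h2 : Real.exp (-((1 - γ / 4) * Real.log (4 * n))) ≤
          Real.exp (-((1 - γ / 4) * L)) := by
        refine Real.exp_le_exp.2 (neg_le_neg (mul_le_mul_of_nonneg_left hL1 (by linarith)))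
      refine le_trans ?_ h2
      have h3 : Real.exp (-((1 - γ / 4) * Real.log (4 * n))) =
          (4 * n : ℝ) ^ (γ / 4) / (4 * n) := by
        rw [Real.rpow_def_of_pos (by positivity)]
        nth_rewrite 3 [← Real.exp_log (by positivity : (0 : ℝ) < 4 * n)]
        rw [← Real.exp_sub]
        ring_nf
      rw [h3]
      gcongr
      linarith
    calc (n : ℝ) ^ (γ / 4) / 4 = n * ((n : ℝ) ^ (γ / 4) / (4 * n)) := by field_simp
      _ ≤ m * Q := by gcongr
  refine (choose_mul_pow_le_exp hnm hQ0 hQ1 (by positivity : 0 ≤ γ / 8) (by linarith)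
    hexcess).trans (Real.exp_le_exp.2 (neg_le_neg ?_))
  calc γ ^ 2 / 2048 * (n : ℝ) ^ (γ / 4) = (n : ℝ) ^ (γ / 4) / 4 * (γ / 8) ^ 2 / 8 := by ring
    _ ≤ _ := by gcongr

theorem eventually_large {γ : ℝ} (hγ : 0 < γ) :
    ∀ᶠ n : ℕ in Filter.atTop, 100 ≤ n ∧ 8 / γ ≤ Real.log n ∧ 4 * (Real.log n) ^ 2 ≤ n ∧
      16 * (Real.log n) ^ 4 + 6 * Real.log n ≤ γ ^ 2 / 2048 * (n : ℝ) ^ (γ / 4) := by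
  have hlog : Filter.Tendsto (fun n : ℕ => Real.log n) Filter.atTop Filter.atTop :=
    Real.tendsto_log_atTop.comp tendsto_natCast_atTop_atTop
  have h1 : ∀ᶠ n : ℕ in Filter.atTop, Real.log n ^ 2 ≤ 1 / 4 * (n : ℝ) := by
    have h := (isLittleO_log_rpow_rpow_atTop 2 one_pos).bound (by norm_num : (0 : ℝ) < 1 / 4)
    filter_upwards [tendsto_natCast_atTop_atTop.eventually h] with n hn
    simpa using hn
  have h2 : ∀ᶠ n : ℕ in Filter.atTop,
      Real.log n ^ 4 ≤ γ ^ 2 / 2048 / 22 * (n : ℝ) ^ (γ / 4) := by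
    have h := (isLittleO_log_rpow_rpow_atTop 4 (by positivity : 0 < γ / 4)).bound
      (by positivity : (0 : ℝ) < γ ^ 2 / 2048 / 22)
    filter_upwards [tendsto_natCast_atTop_atTop.eventually h] with n hn
    have h4 : Real.log n ^ (4 : ℝ) = Real.log n ^ 4 := by exact_mod_cast Real.rpow_natCast _ 4
    rw [h4, Real.norm_of_nonneg (by positivity), Real.norm_of_nonneg (by positivity)] at hn
    exact hn
  filter_upwards [Filter.eventually_ge_atTop 100, hlog.eventually_ge_atTop (8 / γ),
    hlog.eventually_ge_atTop 1, h1, h2] with n hn hl hl1 h1 h2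
  refine ⟨hn, hl, by linarith, ?_⟩
  have : Real.log n ≤ Real.log n ^ 4 := le_self_pow₀ hl1 (by norm_num)
  linarith

/-- At the rate `(1 - γ / 2) log n` of proposals per job, about `n ^ (γ / 2)` of the `n` jobs are
expected to receive no proposal. -/
theorem exp_neg_mul_exp_neg_le {n : ℕ} {γ : ℝ} (hγ0 : 0 < γ) (hγ1 : γ < 1) (hn : 100 ≤ n) :
    Real.exp (-(n * Real.exp (-(n / (n / ((1 - γ / 2) * Real.log n)) + 1 / n)))) ≤
      Real.exp (-(γ ^ 2 / 2048 * (n : ℝ) ^ (γ / 4))) := by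
  have hn1 : (100 : ℝ) ≤ n := by exact_mod_cast hn
  have hn' : (0 : ℝ) < n := by linarith
  have hrate : n / (n / ((1 - γ / 2) * Real.log n)) = (1 - γ / 2) * Real.log n := by
    field_simp
  refine Real.exp_le_exp.2 (neg_le_neg ?_)
  have h1 : (n : ℝ) * Real.exp (-(n / (n / ((1 - γ / 2) * Real.log n)) + 1 / n)) =
      (n : ℝ) ^ (γ / 2) * Real.exp (-(1 / n)) := by
    rw [hrate, Real.rpow_def_of_pos hn']
    nth_rewrite 1 [← Real.exp_log hn']
    rw [← Real.exp_add, ← Real.exp_add]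
    ring_nf
  have h2 : 1 / 2048 ≤ Real.exp (-(1 / (n : ℝ))) := by
    have h3 := Real.add_one_le_exp (-(1 / (n : ℝ)))
    have h4 : 1 / (n : ℝ) ≤ 1 / 100 := one_div_le_one_div_of_le (by norm_num) hn1
    linarith
  have h5 : (n : ℝ) ^ (γ / 4) ≤ (n : ℝ) ^ (γ / 2) :=
    Real.rpow_le_rpow_of_exponent_le (by linarith) (by linarith)
  have hκ1 : γ ^ 2 / 2048 ≤ 1 / 2048 := by nlinarith
  rw [h1, mul_comm]
  exact mul_le_mul h5 (hκ1.trans h2) (by positivity) (by positivity)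

theorem one_div_pow_le_exp_neg {n : ℕ} {γ : ℝ} (hγ0 : 0 < γ) (hγ1 : γ < 1) (hn : 100 ≤ n) :
    (1 / 25 : ℝ) ^ n ≤ Real.exp (-(γ ^ 2 / 2048 * (n : ℝ) ^ (γ / 4))) := by
  have hn1 : (100 : ℝ) ≤ n := by exact_mod_cast hn
  have h1 : (1 / 25 : ℝ) ≤ Real.exp (-1) := by
    rw [Real.exp_neg, ← one_div]
    refine one_div_le_one_div_of_le (Real.exp_pos 1) ?_
    linarith [Real.exp_one_lt_d9]
  have h2 : (n : ℝ) ^ (γ / 4) ≤ n := by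
    calc (n : ℝ) ^ (γ / 4) ≤ (n : ℝ) ^ (1 : ℝ) :=
          Real.rpow_le_rpow_of_exponent_le (by linarith) (by linarith)
      _ = n := Real.rpow_one _
  have hκ1 : γ ^ 2 / 2048 ≤ 1 := by nlinarith
  calc (1 / 25 : ℝ) ^ n ≤ Real.exp (-1) ^ n := by gcongr
    _ = Real.exp (-n) := by rw [← Real.exp_nat_mul]; ring_nf
    _ ≤ _ := by
      refine Real.exp_le_exp.2 (neg_le_neg ?_)
      have : 0 ≤ (n : ℝ) ^ (γ / 4) := by positivity
      nlinarith

theorem moment_le_pow_five_mul {n d : ℕ} {β δ ε : ℝ} (hn : 100 ≤ n) (hdn : d ≤ n) (hβ : 0 ≤ β)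
    (hδ0 : 0 ≤ δ) (hδ : δ ≤ β) (hε0 : 0 ≤ ε) (hε : ε ≤ β) :
    100 * d * n * (Real.exp 2 * n * (β + δ)) + Real.exp 1 * n * ε ≤ (n : ℝ) ^ 5 * β := by
  have hn1 : (100 : ℝ) ≤ n := by exact_mod_cast hn
  have he1 : Real.exp 1 ≤ 3 := by linarith [Real.exp_one_lt_d9]
  have he2 : Real.exp 2 ≤ 9 := by
    rw [show (2 : ℝ) = 1 + 1 by norm_num, Real.exp_add]
    nlinarith [Real.exp_pos 1]
  have hdn' : (d : ℝ) ≤ n := by exact_mod_cast hdn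
  have h1 : (10000 : ℝ) ≤ (n : ℝ) ^ 2 := by nlinarith
  have h2 : 10000 * (n : ℝ) ^ 3 ≤ (n : ℝ) ^ 2 * (n : ℝ) ^ 3 := by gcongr
  have h3 : (n : ℝ) ≤ (n : ℝ) ^ 3 := le_self_pow₀ (by linarith) (by norm_num)
  calc _ ≤ 100 * n * n * (9 * n * (β + β)) + 3 * n * β := by gcongr
    _ = (1800 * (n : ℝ) ^ 3 + 3 * n) * β := by ring
    _ ≤ (n : ℝ) ^ 5 * β := by
      refine mul_le_mul_of_nonneg_right ?_ hβ
      calc 1800 * (n : ℝ) ^ 3 + 3 * n ≤ 10000 * (n : ℝ) ^ 3 := by linarith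
        _ ≤ (n : ℝ) ^ 2 * (n : ℝ) ^ 3 := h2
        _ = (n : ℝ) ^ 5 := by ring

/-- The two ingredients balance at polynomial cost: the moment is at most
`exp (16 (log n) ^ 4) n ^ 5 exp (-κ n ^ (γ / 4))`. -/
theorem measure_hasPerfectStableMatching_le_inv {n m d : ℕ} {γ L : ℝ} (hγ0 : 0 < γ)
    (hγ1 : γ < 1) (hn : 100 ≤ n) (hlog : 8 / γ ≤ Real.log n) (hlog2 : 4 * (Real.log n) ^ 2 ≤ n)
    (hpoly : 16 * (Real.log n) ^ 4 + 6 * Real.log n ≤ γ ^ 2 / 2048 * (n : ℝ) ^ (γ / 4))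
    (hnm : n ≤ m) (hm : m ≤ 2 * n) (hL0 : 1 / 2 ≤ L) (hL1 : L ≤ Real.log (4 * n))
    (hmL : (m : ℝ) - n ≤ m * Real.exp (-L)) (hd : (d : ℝ) < (1 - γ) * Real.log n * L) :
    d ≤ n ∧ (candidateListLaw m n d).real {ω | ω.toInstance.HasPerfectStableMatching} ≤ 1 / n := by
  have hn0 : 0 < n := by omega
  have hn1 : (100 : ℝ) ≤ n := by exact_mod_cast hn
  have hn' : (0 : ℝ) < n := by positivity
  have hlog0 : 0 < Real.log n := lt_of_lt_of_le (by positivity) hlog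
  have hd2 : (d : ℝ) ≤ 2 * Real.log n ^ 2 := by
    have h4 : Real.log (4 * n) ≤ 2 * Real.log n := by
      rw [two_mul, ← Real.log_mul hn'.ne' hn'.ne']
      exact Real.log_le_log (by positivity) (by nlinarith)
    calc (d : ℝ) ≤ (1 - γ) * Real.log n * L := hd.le
      _ ≤ 1 * Real.log n * (2 * Real.log n) := by
        gcongr
        · linarith
        · linarith
      _ = _ := by ring
  have hdn : 2 * d ≤ n := by
    have : 2 * (d : ℝ) ≤ n := by linarith
    exact_mod_cast this
  refine ⟨by omega, ?_⟩
  refine (measure_hasPerfectStableMatching_le hn0 (by omega : d ≤ n)).trans ?_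
  rcases Nat.eq_zero_or_pos d with rfl | hd0
  · simp [momentIntegrand, hn0.ne']
  set κ := γ ^ 2 / 2048 with hκ
  set β := Real.exp (-(κ * (n : ℝ) ^ (γ / 4))) with hβ
  have hγ2 : 0 < 1 - γ / 2 := by linarith
  have hs₀ : 0 < n / ((1 - γ / 2) * Real.log n) := by positivity
  -- The split point: a job's mean acceptance is `s / n = 1 / ((1 - γ / 2) log n)`.
  have hint := integral_momentIntegrand_le hn0 hd0 hnm hm hs₀ (Real.exp_pos _).le
    fun s h0 _ hs => choose_mul_rejection_le hn0 hnm hγ0 hγ1 hlog hL0 hL1 hmL hd h0 hs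
  rw [← hκ, ← hβ] at hint
  have hβ0 : 0 < β := Real.exp_pos _
  have hmoment := moment_le_pow_five_mul hn (by omega : d ≤ n) hβ0.le (Real.exp_pos _).le
    (exp_neg_mul_exp_neg_le hγ0 hγ1 hn) (by positivity) (one_div_pow_le_exp_neg hγ0 hγ1 hn)
  have hlists := pow_div_descFactorial_pow_le hdn hn0 hm
  have hint0 : (0 : ℝ) ≤ m.descFactorial n * ∫ z : Fin n → unitInterval,
      momentIntegrand n m d (cubeMean z) := by
    refine mul_nonneg (Nat.cast_nonneg _) (integral_nonneg fun z => ?_)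
    have := cubeMean_nonneg z
    dsimp only [Pi.zero_apply, momentIntegrand]
    positivity
  calc _ ≤ Real.exp (4 * (d : ℝ) ^ 2) * ((n : ℝ) ^ 5 * β) :=
        mul_le_mul hlists (hint.trans hmoment) hint0 (Real.exp_pos _).le
    _ ≤ Real.exp (16 * Real.log n ^ 4) * ((n : ℝ) ^ 5 * β) := by
        have : (d : ℝ) ^ 2 ≤ (2 * Real.log n ^ 2) ^ 2 := by gcongr
        refine mul_le_mul_of_nonneg_right (Real.exp_le_exp.2 ?_) (by positivity)
        linarith
    _ = Real.exp (16 * Real.log n ^ 4 + 5 * Real.log n - κ * (n : ℝ) ^ (γ / 4)) := by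
        have h5 : (n : ℝ) ^ 5 = Real.exp (5 * Real.log n) := by
          nth_rewrite 1 [← Real.exp_log hn']
          rw [← Real.exp_nat_mul]
          norm_num
        rw [h5, hβ, ← Real.exp_add, ← Real.exp_add]
        ring_nf
    _ ≤ Real.exp (-Real.log n) := Real.exp_le_exp.2 (by linarith)
    _ = 1 / n := by rw [Real.exp_neg, Real.exp_log hn', one_div]

theorem theorem4 :
    ∃ c : ℝ, 0 < c ∧ ∀ γ : ℝ, 0 < γ → ∃ N : ℕ, ∀ (n m d : ℕ) (α : ℝ),
      N ≤ n → 0 ≤ α → (m : ℝ) = n * (1 + α) →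
      (d : ℝ) < (1 - γ) * Real.log n * Real.log ((1 + α) / (α + 1 / (n * (1 + α)))) →
      1 - (α + 1 / n) ^ (c * γ) ≤
        (candidateListLaw m n d).real
          {ω | ¬ ω.toInstance.HasPerfectStableMatching} := by
  -- `c = 1` works: the hypothesis on `d` forces `γ < 1`, so that `1 / n ≤ (α + 1 / n) ^ γ`.
  refine ⟨1, one_pos, fun γ hγ => ?_⟩
  obtain ⟨N, hN⟩ := Filter.eventually_atTop.1 (eventually_large hγ)
  refine ⟨N, fun n m d α hNn hα hm hd => ?_⟩
  obtain ⟨hn, hlog, hlog2, hpoly⟩ := hN n hNn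
  have hn1 : (100 : ℝ) ≤ n := by exact_mod_cast hn
  have hn0 : (0 : ℝ) < n := by linarith
  rw [one_mul]
  rcases le_or_gt 1 (α + 1 / n) with hbig | hsmall
  · exact (sub_nonpos.2 (Real.one_le_rpow hbig hγ.le)).trans measureReal_nonneg
  obtain ⟨hL0, hL1, hmL⟩ := log_threshold_bounds (by omega) hα hsmall hm rfl
  have hγ1 : γ < 1 := by
    by_contra hge
    push Not at hge
    have : (1 - γ) * Real.log n *
        Real.log ((1 + α) / (α + 1 / (n * (1 + α)))) ≤ 0 :=
      mul_nonpos_of_nonpos_of_nonneg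
        (mul_nonpos_of_nonpos_of_nonneg (by linarith) (Real.log_natCast_nonneg n)) (by linarith)
    have : (0 : ℝ) ≤ d := Nat.cast_nonneg d
    linarith
  have hnm : n ≤ m := by
    have : (n : ℝ) ≤ m := by
      rw [hm]
      nlinarith
    exact_mod_cast this
  have hm2 : m ≤ 2 * n := by
    have : 0 < 1 / (n : ℝ) := by positivity
    have : (m : ℝ) ≤ 2 * n := by
      rw [hm]
      nlinarith
    exact_mod_cast this
  obtain ⟨hdn, hperf⟩ := measure_hasPerfectStableMatching_le_inv hγ hγ1 hn hlog hlog2 hpoly hnm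
    hm2 hL0 hL1 hmL hd
  refine le_trans (sub_le_sub_left (hperf.trans ?_) 1)
    (one_sub_le_measure_not_hasPerfectStableMatching hdn)
  calc 1 / (n : ℝ) ≤ α + 1 / n := by linarith
    _ = (α + 1 / n) ^ (1 : ℝ) := (Real.rpow_one _).symm
    _ ≤ (α + 1 / n) ^ γ :=
      Real.rpow_le_rpow_of_exponent_ge (by positivity) hsmall.le hγ1.le
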